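/- A \emph{frame} is a complete lattice in which binary meets distribute over arbitrary joins; a locale $X$ is given by its frame of opens $\Omega X$, and a locale map $f\colon X\to Y$ by a map $f^{-1}\colon\Omega Y\to\Omega X$ preserving finite meets and all joins. The product $X\times X$ has as frame of opens the frame coproduct $\Omega X\otimes\Omega X$, which is generated by the rectangles $U\otimes V$. A \emph{sublocale} of a locale $Y$ is a subset of $\Omega Y$ closed under all meets and under $x\to(-)$ for every $x\in\Omega Y$; sublocales are ordered by inclusion. A \emph{localic relation} on $X$ is a sublocale $R\rightarrowtail X\times X$; its source and target $s,t\colon R\to X$ are the composites of the inclusion with the two projections. The \emph{diagonal} $\Delta$ is the image of $(\mathrm{id},\mathrm{id})\colon X\to X\times X$, the \emph{opposite} $R^{\mathrm{op}}$ is the image of $(t,s)\colon R\to X\times X$, and $R\circ R$ is the image of $(s\pi_1,t\pi_2)\colon P\to X\times X$, where $P=R\times_X R$ is the pullback with $t\pi_1=s\pi_2$. The relation $R$ is \emph{reflexive} if $\Delta\subseteq R$, \emph{transitive} if $R\circ R\subseteq R$, and \emph{symmetric} if $R=R^{\mathrm{op}}$. A \emph{conic frame} $(\Omega X,\uparrow,\downarrow)$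 is a frame with two maps $\uparrow,\downarrow\colon\Omega X\to\Omega X$ that preserve all joins and are parallel: for all $U,V\in\Omega X$, \[ \uparrow U\wedge V\le\ \uparrow(U\wedge\downarrow V)\quad\text{and}\quad U\wedge\downarrow V\le\ \downarrow(\uparrow U\wedge V). \] On rectangles of $\Omega X\otimes\Omega X$ put $A\otimes B\sim C\otimes D$ iff $\uparrow A\wedge B=\uparrow C\wedge D$ and $A\wedge\downarrow B=C\wedge\downarrow D$. The induced localic relation $R_{\uparrow\downarrow}$ on $X$ is the sublocale of $X\times X$ consisting of the $\sim$-saturated elements, that is, of those $O\in\Omega X\otimes\Omega X$ such that, whenever $W\sim W'$, for all $Z$ one has $W\wedge Z\le O$ iff $W'\wedge Z\le O$. \textbf{Proposition.} For every conic frame $(\Omega X,\uparrow,\downarrow)$, the relation $R_{\uparrow\downarrow}$ is \begin{itemize} \item reflexive iff $\uparrow$ and $\downarrow$ are inflationary, i.e. $U\le\ \uparrow U$ and $U\le\ \downarrow U$ for all $U\in\Omega X$; \item transitive iff $\uparrow$ and $\downarrow$ are subidempotent, i.e. $\uparrow\uparrow U\le\ \uparrow U$ and $\downarrow\downarrow U\le\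 \downarrow U$ for all $U\in\Omega X$; \item symmetric iff $\uparrow=\downarrow$. \end{itemize} -/

import Mathlib

/-! Locales are handled through their frames of opens: a locale `X` is a frame `L`, and a locale map
`X → Y` is a `FrameHom` in the opposite direction.  Sublocales are Mathlib's `Sublocale`, ordered by
inclusion of sublocale sets, and `S.restrict : FrameHom L S` is the frame map of the inclusion of the
sublocale `S`. -/

noncomputable section

namespace ConicFrames

universe u v w

section Coproduct

/-- The lower sets of `L × M` that are closed under joins in each coordinate separately, as a
sublocale of the frame of all lower sets. -/
def biideals (L : Type u) (M : Type v) [Order.Frame L] [Order.Frame M] :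
    Sublocale (LowerSet (L × M)) where
  carrier := {D | (∀ (A : Set L) (y : M), (∀ a ∈ A, (a, y) ∈ D) → (sSup A, y) ∈ D) ∧
    (∀ (x : L) (B : Set M), (∀ b ∈ B, (x, b) ∈ D) → (x, sSup B) ∈ D)}
  sInf_mem' := by
    intro s hs
    refine ⟨fun A y h => ?_, fun x B h => ?_⟩
    · rw [LowerSet.mem_sInf_iff]
      exact fun D hD => (hs hD).1 A y fun a ha => LowerSet.mem_sInf_iff.1 (h a ha) D hD
    · rw [LowerSet.mem_sInf_iff]
      exact fun D hD => (hs hD).2 x B fun b hb => LowerSet.mem_sInf_iff.1 (h b hb) D hD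
  himp_mem' := by
    intro E D hD
    have key : ∀ p : L × M, p ∈ E ⇨ D ↔ ∀ q ≤ p, q ∈ E → q ∈ D := by
      intro p
      rw [← LowerSet.Iic_le, le_himp_iff]
      exact ⟨fun h q hq hE => h ⟨hq, hE⟩, fun h q hq => h q hq.1 hq.2⟩
    refine ⟨fun A y h => ?_, fun x B h => ?_⟩
    · rw [key]
      rintro ⟨a, b⟩ hq hE
      have h1 : a = sSup ((fun z => a ⊓ z) '' A) := by
        rw [sSup_image, ← inf_sSup_eq, inf_eq_left.2 hq.1]
      rw [h1]
      refine hD.1 _ _ ?_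
      rintro _ ⟨z, hz, rfl⟩
      exact (key _).1 (h z hz) _ ⟨inf_le_right, hq.2⟩ (E.lower (show (a ⊓ z, b) ≤ (a, b) from ⟨inf_le_left, le_rfl⟩) hE)
    · rw [key]
      rintro ⟨a, b⟩ hq hE
      have h1 : b = sSup ((fun z => b ⊓ z) '' B) := by
        rw [sSup_image, ← inf_sSup_eq, inf_eq_left.2 hq.2]
      rw [h1]
      refine hD.2 _ _ ?_
      rintro _ ⟨z, hz, rfl⟩
      exact (key _).1 (h z hz) _ ⟨hq.1, inf_le_right⟩ (E.lower (show (a, b ⊓ z) ≤ (a, b) from ⟨le_rfl, inf_le_left⟩) hE)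

/-- The coproduct `L ⊗ M` of two frames, i.e. the frame of opens of the product locale. -/
abbrev Coprod (L : Type u) (M : Type v) [Order.Frame L] [Order.Frame M] : Type (max u v) :=
  ↥(biideals L M)

variable {L : Type u} {M : Type v} {N : Type w} [Order.Frame L] [Order.Frame M] [Order.Frame N]

/-- The rectangle `x ⊗ y`: the least element of `L ⊗ M` that contains the pair `(x, y)`. -/
def rect (x : L) (y : M) : Coprod L M := (biideals L M).restrict (LowerSet.Iic (x, y))

theorem rect_le_iff {x : L} {y : M} {D : Coprod L M} : rect x y ≤ D ↔ (x, y) ∈ D.1 := by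
  unfold rect
  rw [(biideals L M).giRestrict.gc.le_iff_le, LowerSet.Iic_le]

theorem coprod_le_iff {D E : Coprod L M} : D ≤ E ↔ ∀ x y, rect x y ≤ D → rect x y ≤ E := by
  refine ⟨fun h x y hD => hD.trans h, fun h => ?_⟩
  rintro ⟨x, y⟩ hD
  exact rect_le_iff.1 (h x y (rect_le_iff.2 hD))

theorem rect_inf_rect (x x' : L) (y y' : M) :
    rect x y ⊓ rect x' y' = rect (x ⊓ x') (y ⊓ y') := by
  unfold rect
  rw [← map_inf]
  congr 1
  ext p
  simp only [LowerSet.coe_inf, LowerSet.coe_Iic, Set.mem_inter_iff, Set.mem_Iic, Prod.le_def,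
    le_inf_iff]
  tauto

theorem rect_top_top : rect (⊤ : L) (⊤ : M) = ⊤ := by
  rw [eq_top_iff, coprod_le_iff]
  intro x y _
  exact rect_le_iff.2 ((rect (⊤ : L) (⊤ : M)).1.lower ⟨le_top, le_top⟩ (rect_le_iff.1 le_rfl))

theorem rect_sSup_left (A : Set L) (y : M) : rect (sSup A) y = ⨆ a ∈ A, rect a y := by
  apply le_antisymm
  · exact rect_le_iff.2 ((⨆ a ∈ A, rect a y : Coprod L M).2.1 A y fun a ha =>
      rect_le_iff.1 (le_iSup₂ (f := fun a (_ : a ∈ A) => rect a y) a ha))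
  · exact iSup₂_le fun a ha => rect_le_iff.2
      ((rect (sSup A) y).1.lower (show (a, y) ≤ (sSup A, y) from ⟨le_sSup ha, le_rfl⟩)
        (rect_le_iff.1 le_rfl))

theorem rect_sSup_right (x : L) (B : Set M) : rect x (sSup B) = ⨆ b ∈ B, rect x b := by
  apply le_antisymm
  · exact rect_le_iff.2 ((⨆ b ∈ B, rect x b : Coprod L M).2.2 x B fun b hb =>
      rect_le_iff.1 (le_iSup₂ (f := fun b (_ : b ∈ B) => rect x b) b hb))
  · exact iSup₂_le fun b hb => rect_le_iff.2
      ((rect x (sSup B)).1.lower (show (x, b) ≤ (x, sSup B) from ⟨le_rfl, le_sSup hb⟩)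
        (rect_le_iff.1 le_rfl))

/-- The first coproduct injection `x ↦ x ⊗ ⊤`, i.e. the first product projection of locales. -/
def inl : FrameHom L (Coprod L M) where
  toFun x := rect x ⊤
  map_inf' x y := by simp [rect_inf_rect]
  map_top' := rect_top_top
  map_sSup' s := by rw [rect_sSup_left, sSup_image]

/-- The second coproduct injection `y ↦ ⊤ ⊗ y`, i.e. the second product projection of locales. -/
def inr : FrameHom M (Coprod L M) where
  toFun y := rect ⊤ y
  map_inf' x y := by simp [rect_inf_rect]
  map_top' := rect_top_top
  map_sSup' s := by rw [rect_sSup_right, sSup_image]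

/-- The right adjoint of the copairing. -/
def copairAdj (h : FrameHom L N) (k : FrameHom M N) (n : N) : Coprod L M where
  val := ⟨{p | h p.1 ⊓ k p.2 ≤ n}, fun _ _ hpq hp =>
    (inf_le_inf (OrderHomClass.mono h hpq.1) (OrderHomClass.mono k hpq.2)).trans hp⟩
  property := by
    refine ⟨fun A y hA => ?_, fun x B hB => ?_⟩
    · change h (sSup A) ⊓ k y ≤ n
      rw [map_sSup, sSup_inf_eq, iSup₂_le_iff]
      rintro _ ⟨a, ha, rfl⟩
      exact hA a ha
    · change h x ⊓ k (sSup B) ≤ n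
      rw [map_sSup, inf_sSup_eq, iSup₂_le_iff]
      rintro _ ⟨b, hb, rfl⟩
      exact hB b hb

theorem copair_gc (h : FrameHom L N) (k : FrameHom M N) :
    GaloisConnection (fun D : Coprod L M => ⨆ p ∈ D.1, h p.1 ⊓ k p.2) (copairAdj h k) :=
  fun _ _ => iSup₂_le_iff

/-- The copairing `[h, k] : L ⊗ M → N`, i.e. the pairing of locale maps into a product. -/
def copair (h : FrameHom L N) (k : FrameHom M N) : FrameHom (Coprod L M) N where
  toFun D := ⨆ p ∈ D.1, h p.1 ⊓ k p.2
  map_inf' D E := by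
    apply le_antisymm
    · exact (copair_gc h k).monotone_l.map_inf_le D E
    · rw [iSup₂_inf_eq]
      refine iSup₂_le fun p hp => ?_
      rw [inf_iSup₂_eq]
      refine iSup₂_le fun q hq => ?_
      refine le_trans (le_of_eq ?_) (le_iSup₂_of_le (p ⊓ q)
        ⟨D.1.lower inf_le_left hp, E.1.lower inf_le_right hq⟩ le_rfl)
      simp only [Prod.fst_inf, Prod.snd_inf, map_inf]
      exact inf_inf_inf_comm _ _ _ _
  map_top' := by
    rw [eq_top_iff]
    exact le_iSup₂_of_le (⊤ : L × M) trivial (by simp)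
  map_sSup' s := by rw [(copair_gc h k).l_sSup, sSup_image]

theorem copair_rect (h : FrameHom L N) (k : FrameHom M N) (x : L) (y : M) :
    copair h k (rect x y) = h x ⊓ k y := by
  apply le_antisymm
  · exact (copair_gc h k _ _).2 (rect_le_iff.2 (le_refl (h x ⊓ k y)))
  · exact le_iSup₂_of_le (f := fun (p : L × M) (_ : p ∈ (rect x y).1) => h p.1 ⊓ k p.2)
      (x, y) (rect_le_iff.1 le_rfl) le_rfl

end Coproduct

section Quotient

variable {L : Type u} [Order.Frame L]

/-- The quotient `L/∼` of a frame by an arbitrary binary relation: the sublocale of saturated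
elements.  Its quotient map `μ_∼` is `(quot r).restrict`. -/
def quot (r : L → L → Prop) : Sublocale L where
  carrier := {s | ∀ a b c, r a b → (a ⊓ c ≤ s ↔ b ⊓ c ≤ s)}
  sInf_mem' := by
    intro S hS a b c hab
    simp only [le_sInf_iff]
    exact forall₂_congr fun s hs => hS hs a b c hab
  himp_mem' := by
    intro x s hs a b c hab
    rw [le_himp_iff, le_himp_iff, inf_assoc, inf_assoc]
    exact hs a b (c ⊓ x) hab

/-- The image of the locale map given by the frame map `h : L → N`, as a sublocale: the set of
values of the right adjoint of `h`. -/
def image {N : Type v} [Order.Frame N] (h : FrameHom L N) : Sublocale L where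
  carrier := {a | ∃ n : N, ∀ b, h b ≤ n ↔ b ≤ a}
  sInf_mem' := by
    intro S hS
    choose f hf using hS
    refine ⟨⨅ a : S, f a.2, fun b => ?_⟩
    rw [le_iInf_iff, le_sInf_iff, Subtype.forall]
    exact forall₂_congr fun a ha => hf ha b
  himp_mem' := by
    rintro x a ⟨n, hn⟩
    refine ⟨h x ⇨ n, fun b => ?_⟩
    rw [le_himp_iff, le_himp_iff, ← map_inf, hn]

end Quotient

section Relations

/-- A localic relation on the locale with frame of opens `L`: a sublocale of the product. -/
abbrev LocRel (L : Type u) [Order.Frame L] : Type u := Sublocale (Coprod L L)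

variable {L : Type u} [Order.Frame L]

namespace LocRel

/-- The frame map `s⁻¹` of the source map `s : R → X`. -/
def source (R : LocRel L) : FrameHom L R := R.restrict.comp inl

/-- The frame map `t⁻¹` of the target map `t : R → X`. -/
def target (R : LocRel L) : FrameHom L R := R.restrict.comp inr

/-- The diagonal relation: the image of `(id, id) : X → X × X`. -/
def diagonal (L : Type u) [Order.Frame L] : LocRel L :=
  image (copair (FrameHom.id L) (FrameHom.id L))

/-- The opposite relation: the image of `(t, s) : R → X × X`. -/
def op (R : LocRel L) : LocRel L := image (copair R.target R.source)

/-- The pullback `R ×_X Q` of the target map of `R` along the source map of `Q`, as the sublocale of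
`R × Q` on which `t_R ∘ π₁` and `s_Q ∘ π₂` agree. -/
def pullback (R Q : LocRel L) : Sublocale (Coprod R Q) :=
  quot fun a b => ∃ U : L, a = inl (R.target U) ∧ b = inr (Q.source U)

/-- The composite `R ∘ Q`: the image of `(s_R ∘ π₁, t_Q ∘ π₂) : R ×_X Q → X × X`. -/
def comp (R Q : LocRel L) : LocRel L :=
  image (copair (((pullback R Q).restrict.comp inl).comp R.source)
    (((pullback R Q).restrict.comp inr).comp Q.target))

/-- `R` is reflexive if it contains the diagonal. -/
def Reflexive (R : LocRel L) : Prop := diagonal L ≤ R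

/-- `R` is transitive if it contains `R ∘ R`. -/
def Transitive (R : LocRel L) : Prop := comp R R ≤ R

/-- `R` is symmetric if it equals its opposite. -/
def Symmetric (R : LocRel L) : Prop := R = op R

end LocRel

end Relations

section Cones

variable {L : Type u} [Order.Frame L]

/-- `(L, up, down)` is a conic frame: the cones preserve all joins and are parallel. -/
structure IsConicFrame (up down : L → L) : Prop where
  up_sSup : ∀ A : Set L, up (sSup A) = sSup (up '' A)
  down_sSup : ∀ A : Set L, down (sSup A) = sSup (down '' A)
  parallel_up : ∀ x y, up x ⊓ y ≤ up (x ⊓ down y)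
  parallel_down : ∀ x y, x ⊓ down y ≤ down (up x ⊓ y)

/-- The relation `∼` on the rectangles of `L ⊗ L`: `a ⊗ b ∼ c ⊗ d` iff the reduced cones of
`(a, b)` and `(c, d)` agree. -/
def ConeSim (up down : L → L) (W W' : Coprod L L) : Prop :=
  ∃ a b c d : L, W = rect a b ∧ W' = rect c d ∧
    up a ⊓ b = up c ⊓ d ∧ a ⊓ down b = c ⊓ down d

/-- The localic relation induced by a pair of cones: the quotient `(L ⊗ L)/∼`. -/
def inducedRel (up down : L → L) : LocRel L := quot (ConeSim up down)

/-- `x ≤ c x` for all `x`. -/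
def Inflationary (c : L → L) : Prop := ∀ x, x ≤ c x

/-- `c (c x) ≤ c x` for all `x`. -/
def Subidempotent (c : L → L) : Prop := ∀ x, c (c x) ≤ c x

end Cones

end ConicFrames

end

namespace ConicFrames

universe u v w

/-! ### Opens of a product, tested on rectangles -/

section Coproduct

variable {L : Type u} {M : Type v} {N : Type w} [Order.Frame L] [Order.Frame M] [Order.Frame N]

/-! Call `(a ⊓ down b) ⊗ (up a ⊓ b)` the reduction of `a ⊗ b`. Parallelism makes every rectangle
equivalent to its reduction, so an open `O` belongs to the induced relation iff it contains each
rectangle whose reduction it contains (`mem_inducedRel`). The diagonal, the opposite and the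
composite are images, and an open of an image is described by the rectangles it contains
(`mem_image_copair`). Each claim then compares two closure conditions on rectangles.

Opens of the diagonal have the form `a ⊓ b ≤ n`, and they are closed under undoing reductions
exactly when both cones are inflationary. Swapping coordinates exchanges the roles of `up` and
`down`, whence symmetry.

For transitivity, `s⁻¹ a ≤ t⁻¹ (up a)` and `t⁻¹ b ≤ s⁻¹ (down b)` hold in the relation; sliding
these opens across the pullback turns subidempotence into saturation of the opens of the composite.
Conversely, `exists_mem_comp` produces opens of the composite such as `up (up a) ⊓ b ≤ up x`, and
saturation of these forces subidempotence. -/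

theorem rect_mono {x x' : L} {y y' : M} (hx : x ≤ x') (hy : y ≤ y') : rect x y ≤ rect x' y' :=
  rect_le_iff.2 ((rect x' y').1.lower ⟨hx, hy⟩ (rect_le_iff.1 le_rfl))

theorem coprod_ext {D E : Coprod L M} (h : ∀ x y, rect x y ≤ D ↔ rect x y ≤ E) : D = E :=
  le_antisymm (coprod_le_iff.2 fun x y => (h x y).1) (coprod_le_iff.2 fun x y => (h x y).2)

theorem inf_le_iff_forall_rect {W Z D : Coprod L M} :
    W ⊓ Z ≤ D ↔ ∀ x y, rect x y ≤ Z → W ⊓ rect x y ≤ D := by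
  refine ⟨fun h x y hZ => (inf_le_inf_left W hZ).trans h, fun h => ?_⟩
  rw [coprod_le_iff]
  intro x y hxy
  exact (le_inf (hxy.trans inf_le_left) le_rfl).trans (h x y (hxy.trans inf_le_right))

/-- A predicate that turns joins in each coordinate into conjunctions is an open of the product. -/
theorem exists_coprod (F : L → M → Prop) (h₁ : ∀ A y, F (sSup A) y ↔ ∀ a ∈ A, F a y)
    (h₂ : ∀ x B, F x (sSup B) ↔ ∀ b ∈ B, F x b) :
    ∃ D : Coprod L M, ∀ x y, rect x y ≤ D ↔ F x y := by
  have mono₁ : ∀ {a a' y}, a' ≤ a → F a y → F a' y := fun {a a' y} ha hF =>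
    (h₁ {a', a} y).1 (by rwa [sSup_pair, sup_eq_right.2 ha]) a' (by simp)
  have mono₂ : ∀ {x b b'}, b' ≤ b → F x b → F x b' := fun {x b b'} hb hF =>
    (h₂ x {b', b}).1 (by rwa [sSup_pair, sup_eq_right.2 hb]) b' (by simp)
  exact ⟨⟨⟨{p | F p.1 p.2}, fun p q hpq hp => mono₁ hpq.1 (mono₂ hpq.2 hp)⟩,
    fun A y => (h₁ A y).2, fun x B => (h₂ x B).2⟩, fun x y => rect_le_iff⟩

/-- The right adjoint of a copairing is determined by the rectangles below its values, so no other
opens need testing. -/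
theorem mem_image_copair {h : FrameHom L N} {k : FrameHom M N} {O : Coprod L M} :
    O ∈ image (copair h k) ↔ ∃ n : N, ∀ a b, rect a b ≤ O ↔ h a ⊓ k b ≤ n := by
  constructor
  · rintro ⟨n, hn⟩
    exact ⟨n, fun a b => by rw [← hn, copair_rect]⟩
  · rintro ⟨n, hn⟩
    refine ⟨n, fun D => ?_⟩
    have hO : O = copairAdj h k n := coprod_ext fun a b => by
      rw [hn, ← copair_rect]
      exact copair_gc h k _ _
    rw [hO]
    exact copair_gc h k D n

end Coproduct

/-! ### Diagonal, opposite and composite through rectangles -/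

section Relations

variable {L : Type u} [Order.Frame L]

theorem restrict_le_iff {R : Sublocale L} {x : L} {r : R} : R.restrict x ≤ r ↔ x ≤ r.1 :=
  R.giRestrict.gc.le_iff_le

namespace LocRel

variable {R Q : LocRel L}

theorem source_inf_target (a b : L) : R.source a ⊓ R.target b = R.restrict (rect a b) := by
  change R.restrict (rect a ⊤) ⊓ R.restrict (rect ⊤ b) = _
  rw [← map_inf, rect_inf_rect, inf_top_eq, top_inf_eq]

theorem mem_diagonal {O : Coprod L L} :
    O ∈ diagonal L ↔ ∃ n, ∀ a b, rect a b ≤ O ↔ a ⊓ b ≤ n :=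
  mem_image_copair

theorem mem_op {O : Coprod L L} :
    O ∈ op R ↔ ∃ n ∈ R, ∀ a b, rect a b ≤ O ↔ rect b a ≤ n := by
  rw [op, mem_image_copair]
  simp only [inf_comm (target R _), source_inf_target, restrict_le_iff, Subtype.exists, exists_prop]

/-- The test open `Z` in the quotient may be taken to be a rectangle, and its meet with a generator
changes only one side. -/
theorem mem_pullback {n : Coprod R Q} :
    n ∈ pullback R Q ↔
      ∀ U r q, rect (R.target U ⊓ r) q ≤ n ↔ rect r (Q.source U ⊓ q) ≤ n := by
  have hl : ∀ (r₀ r : R) (q : Q), inl r₀ ⊓ rect r q = rect (r₀ ⊓ r) q := fun r₀ r q =>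
    (rect_inf_rect _ _ _ _).trans (by rw [top_inf_eq])
  have hr : ∀ (q₀ : Q) (r : R) (q : Q), inr q₀ ⊓ rect r q = rect r (q₀ ⊓ q) := fun q₀ r q =>
    (rect_inf_rect _ _ _ _).trans (by rw [top_inf_eq])
  constructor
  · intro h U r q
    rw [← hl, ← hr]
    exact h _ _ _ ⟨U, rfl, rfl⟩
  · rintro h _ _ Z ⟨U, rfl, rfl⟩
    rw [inf_le_iff_forall_rect, inf_le_iff_forall_rect]
    refine forall₃_congr fun r q _ => ?_
    rw [hl, hr, h]

theorem mem_comp {O : Coprod L L} :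
    O ∈ comp R Q ↔
      ∃ n ∈ pullback R Q, ∀ a b, rect a b ≤ O ↔ rect (R.source a) (Q.target b) ≤ n := by
  have key : ∀ (n : pullback R Q) (a b : L),
      (((pullback R Q).restrict.comp inl).comp R.source) a ⊓
        (((pullback R Q).restrict.comp inr).comp Q.target) b ≤ n ↔
      rect (R.source a) (Q.target b) ≤ n.1 := by
    intro n a b
    change (pullback R Q).restrict (rect (R.source a) ⊤) ⊓
      (pullback R Q).restrict (rect ⊤ (Q.target b)) ≤ n ↔ _
    rw [← map_inf, rect_inf_rect, inf_top_eq, top_inf_eq, restrict_le_iff]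
  rw [comp, mem_image_copair]
  simp only [key, Subtype.exists, exists_prop]

/-- Opens of the composite `R ∘ Q` obtained from predicates on pairs of rectangles. -/
theorem exists_mem_comp (F : L → L → L → L → Prop)
    (h₁ : ∀ c d, ∃ e ∈ R, ∀ a b, rect a b ≤ e ↔ F a b c d)
    (h₂ : ∀ a b, ∃ e ∈ Q, ∀ c d, rect c d ≤ e ↔ F a b c d)
    (hF : ∀ a b c d U, F a (U ⊓ b) c d ↔ F a b (U ⊓ c) d) :
    ∃ O ∈ comp R Q, ∀ a b, rect a b ≤ O ↔ F a ⊤ ⊤ b := by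
  choose e₁ he₁ h₁ using h₁
  choose e₂ he₂ h₂ using h₂
  -- `G r q` says that `r ⊗ q` lies in the open to be built on `R × Q`.
  let G : R → Q → Prop := fun r q =>
    ∀ a b c d, rect a b ≤ r.1 → rect c d ≤ q.1 → F a b c d
  -- The slices of `F` are elements of `R` and `Q`, not just of the ambient coproduct, so joins
  -- formed in `R` and `Q` can be tested termwise below them.
  have hG₁ : ∀ r q, G r q ↔ ∀ c d, rect c d ≤ q.1 → r ≤ ⟨e₁ c d, he₁ c d⟩ := by
    intro r q
    constructor
    · intro hG c d hq
      exact coprod_le_iff.2 fun a b hr => (h₁ c d a b).2 (hG a b c d hr hq)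
    · intro hG a b c d hr hq
      exact (h₁ c d a b).1 (hr.trans (hG c d hq))
  have hG₂ : ∀ r q, G r q ↔ ∀ a b, rect a b ≤ r.1 → q ≤ ⟨e₂ a b, he₂ a b⟩ := by
    intro r q
    constructor
    · intro hG a b hr
      exact coprod_le_iff.2 fun c d hq => (h₂ a b c d).2 (hG a b c d hr hq)
    · intro hG a b c d hr hq
      exact (h₂ a b c d).1 (hq.trans (hG a b hr))
  obtain ⟨n, hn⟩ := exists_coprod G
    (fun A q => by
      simp only [hG₁, sSup_le_iff]
      exact ⟨fun h r hr c d hq => h c d hq r hr, fun h c d hq r hr => h r hr c d hq⟩)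
    (fun r B => by
      simp only [hG₂, sSup_le_iff]
      exact ⟨fun h q hq a b hr => h a b hr q hq, fun h a b hr q hq => h q hq a b hr⟩)
  -- Moving `r` across the Heyting implication leaves `R.target U` alone on the left, where the
  -- adjunction applies; implication in a sublocale is the ambient one.
  have target_inf_le : ∀ (U : L) (r e : R),
      R.target U ⊓ r ≤ e ↔ ∀ a b, rect a b ≤ r.1 → rect a (U ⊓ b) ≤ e.1 := by
    intro U r e
    rw [← le_himp_iff]
    refine Iff.trans (restrict_le_iff (x := rect ⊤ U) (r := r ⇨ e)) ?_
    rw [Sublocale.coe_himp, le_himp_iff, inf_le_iff_forall_rect]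
    simp only [rect_inf_rect, top_inf_eq]
  have source_inf_le : ∀ (U : L) (q e : Q),
      Q.source U ⊓ q ≤ e ↔ ∀ c d, rect c d ≤ q.1 → rect (U ⊓ c) d ≤ e.1 := by
    intro U q e
    rw [← le_himp_iff]
    refine Iff.trans (restrict_le_iff (x := rect U ⊤) (r := q ⇨ e)) ?_
    rw [Sublocale.coe_himp, le_himp_iff, inf_le_iff_forall_rect]
    simp only [rect_inf_rect, top_inf_eq]
  have hmem : n ∈ pullback R Q := by
    rw [mem_pullback]
    intro U r q
    rw [hn, hn, hG₁, hG₂]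
    simp only [target_inf_le, source_inf_le, h₁, h₂, hF]
    exact ⟨fun h a b hr c d hq => h c d hq a b hr, fun h c d hq a b hr => h a b hr c d hq⟩
  obtain ⟨O, hO⟩ := exists_coprod (fun a b => F a ⊤ ⊤ b)
    (fun A b => by
      simp only [← h₁, rect_sSup_left, iSup_le_iff])
    (fun a B => by
      simp only [← h₂, rect_sSup_right, iSup_le_iff])
  refine ⟨O, mem_comp.2 ⟨n, hmem, fun a b => ?_⟩, hO⟩
  have hs : ∀ e : R, R.source a ≤ e ↔ rect a ⊤ ≤ e.1 := fun e => restrict_le_iff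
  have ht : ∀ e : Q, Q.target b ≤ e ↔ rect ⊤ b ≤ e.1 := fun e => restrict_le_iff
  rw [hO, hn]
  -- `R.source a` and `Q.target b` are the least elements of `R` and `Q` above `a ⊗ ⊤` and `⊤ ⊗ b`,
  -- so testing these two rectangles suffices.
  constructor
  · intro hF'
    rw [hG₁]
    intro c d hq
    rw [hs, h₁, ← h₂]
    exact hq.trans ((ht ⟨e₂ a ⊤, he₂ a ⊤⟩).2 ((h₂ _ _ _ _).2 hF'))
  · intro hG
    exact hG a ⊤ ⊤ b ((hs _).1 le_rfl) ((ht _).1 le_rfl)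

end LocRel

end Relations

/-! ### Saturation for parallel cones, and the three equivalences -/

section Cones

variable {L : Type u} [Order.Frame L] {up down : L → L}

namespace IsConicFrame

theorem up_mono (h : IsConicFrame up down) : Monotone up := by
  intro x y hxy
  have := h.up_sSup {x, y}
  rw [Set.image_pair, sSup_pair, sSup_pair, sup_eq_right.2 hxy] at this
  exact this ▸ le_sup_left

theorem down_mono (h : IsConicFrame up down) : Monotone down := by
  intro x y hxy
  have := h.down_sSup {x, y}
  rw [Set.image_pair, sSup_pair, sSup_pair, sup_eq_right.2 hxy] at this
  exact this ▸ le_sup_left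

theorem up_inf_eq (h : IsConicFrame up down) (a b : L) :
    up (a ⊓ down b) ⊓ b = up a ⊓ b :=
  le_antisymm (inf_le_inf_right b (h.up_mono inf_le_left))
    (le_inf (h.parallel_up a b) inf_le_right)

theorem inf_down_eq (h : IsConicFrame up down) (a b : L) :
    a ⊓ down (up a ⊓ b) = a ⊓ down b :=
  le_antisymm (inf_le_inf_left a (h.down_mono inf_le_right))
    (le_inf inf_le_left (h.parallel_down a b))

theorem rect_coneSim_reduced (h : IsConicFrame up down) (a b : L) :
    ConeSim up down (rect a b) (rect (a ⊓ down b) (up a ⊓ b)) := by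
  refine ⟨a, b, _, _, rfl, rfl, ?_, ?_⟩
  · rw [inf_comm (up a), ← inf_assoc, h.up_inf_eq, inf_assoc, inf_comm b, ← inf_assoc, inf_idem]
  · rw [inf_right_comm, h.inf_down_eq, inf_assoc, inf_idem]

/-- An open is saturated iff it contains every rectangle whose reduced cone it contains. -/
theorem mem_inducedRel (h : IsConicFrame up down) {O : Coprod L L} :
    O ∈ inducedRel up down ↔
      ∀ a b, rect (a ⊓ down b) (up a ⊓ b) ≤ O → rect a b ≤ O := by
  constructor
  · intro hO a b hab
    simpa using (hO _ _ ⊤ (h.rect_coneSim_reduced a b)).2 (by simpa using hab)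
  · intro hO
    -- Saturation must survive meets: the reduction of `(a ⊓ x) ⊗ (b ⊓ y)` lies inside the reduction
    -- of `a ⊗ b` met with `x ⊗ y`, by monotonicity of the cones.
    have key : ∀ a b x y, rect a b ⊓ rect x y ≤ O ↔
        rect (a ⊓ down b) (up a ⊓ b) ⊓ rect x y ≤ O := by
      intro a b x y
      refine ⟨fun h' => (inf_le_inf_right _ (rect_mono inf_le_left inf_le_right)).trans h',
        fun h' => ?_⟩
      rw [rect_inf_rect] at h' ⊢
      refine hO _ _ ((rect_mono ?_ ?_).trans h')
      · refine le_inf (le_inf ?_ ?_) ?_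
        · exact inf_le_left.trans inf_le_left
        · exact inf_le_right.trans (h.down_mono inf_le_left)
        · exact inf_le_left.trans inf_le_right
      · refine le_inf (le_inf ?_ ?_) ?_
        · exact inf_le_left.trans (h.up_mono inf_le_left)
        · exact inf_le_right.trans inf_le_left
        · exact inf_le_right.trans inf_le_right
    rintro _ _ Z ⟨a, b, c, d, rfl, rfl, h₁, h₂⟩
    rw [inf_le_iff_forall_rect, inf_le_iff_forall_rect]
    refine forall₃_congr fun x y _ => ?_
    rw [key, key c d, h₁, h₂]

theorem restrict_reduced (h : IsConicFrame up down) (a b : L) :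
    (inducedRel up down).restrict (rect (a ⊓ down b) (up a ⊓ b)) =
      (inducedRel up down).restrict (rect a b) :=
  le_antisymm (OrderHomClass.mono _ (rect_mono inf_le_left inf_le_right))
    (restrict_le_iff.2 (h.mem_inducedRel.1 (Subtype.property _) a b (restrict_le_iff.1 le_rfl)))

theorem exists_mem_inducedRel (h : IsConicFrame up down) (F : L → L → Prop)
    (h₁ : ∀ A b, F (sSup A) b ↔ ∀ a ∈ A, F a b) (h₂ : ∀ a B, F a (sSup B) ↔ ∀ b ∈ B, F a b)
    (hF : ∀ a b, F (a ⊓ down b) (up a ⊓ b) → F a b) :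
    ∃ e ∈ inducedRel up down, ∀ a b, rect a b ≤ e ↔ F a b := by
  obtain ⟨e, he⟩ := exists_coprod F h₁ h₂
  exact ⟨e, h.mem_inducedRel.2 fun a b => by simpa only [he] using hF a b, he⟩

theorem exists_up_inf_le (h : IsConicFrame up down) (e x : L) :
    ∃ O ∈ inducedRel up down, ∀ a b, rect a b ≤ O ↔ up (e ⊓ a) ⊓ b ≤ x := by
  refine h.exists_mem_inducedRel _ (fun A b => ?_) (fun a B => ?_) fun a b hab => ?_
  · rw [inf_sSup_eq, ← sSup_image, h.up_sSup, sSup_inf_eq]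
    simp
  · rw [inf_sSup_eq]
    simp
  · refine le_trans (le_inf ?_ ?_) hab
    · rw [← inf_assoc]
      exact h.parallel_up _ _
    · exact inf_le_inf_right _ (h.up_mono inf_le_right)

theorem exists_inf_down_le (h : IsConicFrame up down) (e x : L) :
    ∃ O ∈ inducedRel up down, ∀ a b, rect a b ≤ O ↔ a ⊓ down (b ⊓ e) ≤ x := by
  refine h.exists_mem_inducedRel _ (fun A b => ?_) (fun a B => ?_) fun a b hab => ?_
  · rw [sSup_inf_eq]
    simp
  · rw [sSup_inf_eq, ← sSup_image, h.down_sSup, inf_sSup_eq]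
    simp
  · refine le_trans (le_inf ?_ ?_) hab
    · exact inf_le_inf_left _ (h.down_mono inf_le_left)
    · rw [inf_assoc]
      exact h.parallel_down _ _

/-- The condition sees `a ⊗ b` only through `up a ⊓ b`, which reduction leaves unchanged. This is
the slice in the first factor of the open that tests `up (up x) ≤ up x`. -/
theorem exists_up_up_inf_le (h : IsConicFrame up down) (c d x : L) :
    ∃ O ∈ inducedRel up down, ∀ a b, rect a b ≤ O ↔ up (up a ⊓ b ⊓ c) ⊓ d ≤ x := by
  refine h.exists_mem_inducedRel _ (fun A b => ?_) (fun a B => ?_) fun a b hab => ?_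
  · rw [h.up_sSup, sSup_inf_eq, ← sSup_image, sSup_inf_eq, ← sSup_image, h.up_sSup, sSup_inf_eq]
    simp
  · rw [inf_sSup_eq, ← sSup_image, sSup_inf_eq, ← sSup_image, h.up_sSup, sSup_inf_eq]
    simp
  · rwa [inf_left_comm (up _) (up a), h.up_inf_eq, ← inf_assoc (up a), inf_idem] at hab

theorem exists_inf_down_down_le (h : IsConicFrame up down) (a b x : L) :
    ∃ O ∈ inducedRel up down, ∀ c d, rect c d ≤ O ↔ a ⊓ down (b ⊓ (c ⊓ down d)) ≤ x := by
  refine h.exists_mem_inducedRel _ (fun A d => ?_) (fun c B => ?_) fun c d hcd => ?_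
  · rw [sSup_inf_eq, ← sSup_image, inf_sSup_eq, ← sSup_image, h.down_sSup, inf_sSup_eq]
    simp
  · rw [h.down_sSup, inf_sSup_eq, ← sSup_image, inf_sSup_eq, ← sSup_image, h.down_sSup,
      inf_sSup_eq]
    simp
  · rwa [inf_right_comm c, h.inf_down_eq, inf_assoc c, inf_idem] at hcd

theorem reflexive_iff (h : IsConicFrame up down) :
    (inducedRel up down).Reflexive ↔ Inflationary up ∧ Inflationary down := by
  constructor
  · intro hR
    have key : ∀ x, x ≤ x ⊓ down x ⊓ (up x ⊓ x) := by
      intro x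
      -- The bound is the meet of the two sides of the reduction of `x ⊗ x`: the least one for which
      -- the diagonal open contains that reduction.
      obtain ⟨O, hO⟩ := exists_coprod (fun a b : L => a ⊓ b ≤ x ⊓ down x ⊓ (up x ⊓ x))
        (fun A b => by simp only [sSup_inf_eq, iSup_le_iff])
        (fun a B => by simp only [inf_sSup_eq, iSup_le_iff])
      have hmem : O ∈ inducedRel up down := hR (LocRel.mem_diagonal.2 ⟨_, hO⟩)
      simpa only [hO, inf_idem] using h.mem_inducedRel.1 hmem x x ((hO _ _).2 le_rfl)
    exact ⟨fun x => (key x).trans (inf_le_right.trans inf_le_left),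
      fun x => (key x).trans (inf_le_left.trans inf_le_right)⟩
  · rintro ⟨hu, hd⟩ O hO
    obtain ⟨n, hn⟩ := LocRel.mem_diagonal.1 hO
    refine h.mem_inducedRel.2 fun a b hab => ?_
    rw [hn] at hab ⊢
    exact (le_inf (le_inf inf_le_left (inf_le_right.trans (hd b)))
      (le_inf (inf_le_left.trans (hu a)) inf_le_right)).trans hab

theorem transitive_iff (h : IsConicFrame up down) :
    (inducedRel up down).Transitive ↔ Subidempotent up ∧ Subidempotent down := by
  constructor
  · intro hR
    constructor
    · intro x
      obtain ⟨O, hO, hOF⟩ := LocRel.exists_mem_comp (R := inducedRel up down)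
        (Q := inducedRel up down) (fun a b c d => up (up a ⊓ b ⊓ c) ⊓ d ≤ up x)
        (fun c d => h.exists_up_up_inf_le c d (up x))
        (fun a b => h.exists_up_inf_le (up a ⊓ b) (up x))
        (fun a b c d U => by rw [inf_left_comm, inf_comm U, inf_assoc (up a ⊓ b)])
      -- The second side of the reduction of `x ⊗ ⊤` is `up x`, so `O` contains the reduction at
      -- once; containing `x ⊗ ⊤` itself says `up (up x) ≤ up x`.
      have := h.mem_inducedRel.1 (hR hO) x ⊤ ((hOF _ _).2 (inf_le_right.trans inf_le_left))
      simpa only [hOF, inf_top_eq] using this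
    · intro x
      obtain ⟨O, hO, hOF⟩ := LocRel.exists_mem_comp (R := inducedRel up down)
        (Q := inducedRel up down) (fun a b c d => a ⊓ down (b ⊓ (c ⊓ down d)) ≤ down x)
        (fun c d => h.exists_inf_down_le (c ⊓ down d) (down x))
        (fun a b => h.exists_inf_down_down_le a b (down x))
        (fun a b c d U => by rw [inf_comm U b, inf_assoc b, inf_assoc U])
      have := h.mem_inducedRel.1 (hR hO) ⊤ x ((hOF _ _).2 (inf_le_left.trans inf_le_right))
      simpa only [hOF, top_inf_eq] using this
  · rintro ⟨hu, hd⟩ O hO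
    obtain ⟨n, hn, hOn⟩ := LocRel.mem_comp.1 hO
    rw [LocRel.mem_pullback] at hn
    refine h.mem_inducedRel.2 fun a b hab => ?_
    rw [hOn] at hab ⊢
    set s := (inducedRel up down).source
    set t := (inducedRel up down).target
    have hst : ∀ a b, s a ⊓ t b = s (a ⊓ down b) ⊓ t (up a ⊓ b) := fun a b => by
      rw [LocRel.source_inf_target, LocRel.source_inf_target, h.restrict_reduced]
    have hs : ∀ a b, s a ⊓ t b ≤ s (a ⊓ down b) := fun a b => (hst a b).le.trans inf_le_left
    have ht : ∀ a b, s a ⊓ t b ≤ t (up a ⊓ b) := fun a b => (hst a b).le.trans inf_le_right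
    have hsu : ∀ a, s a ≤ t (up a) := fun a => by
      simpa only [map_top, inf_top_eq] using ht a ⊤
    have htd : ∀ b, t b ≤ s (down b) := fun b => by
      simpa only [map_top, top_inf_eq] using hs ⊤ b
    -- The factor `s (down (up a ⊓ b))` moves to the left as `t (down (up a ⊓ b))`; meeting it with
    -- `s a` bounds the left side by `s (a ⊓ down (down (up a ⊓ b)))`, and subidempotence removes
    -- one `down`.
    have hsn : rect (s a) (t (up a ⊓ b)) ≤ n := by
      rw [← inf_eq_right.2 (htd (up a ⊓ b)), ← hn]
      refine (rect_mono ?_ le_rfl).trans hab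
      rw [inf_comm]
      refine (hs _ _).trans (OrderHomClass.mono s (inf_le_inf_left a ?_))
      exact (hd _).trans (h.down_mono inf_le_right)
    -- The mirror move: `t (up a)` crosses to the right as `s (up a)`, where its meet with `t b` is
    -- below `t (up (up a) ⊓ b)`.
    rw [← inf_eq_right.2 (hsu a), hn]
    exact (rect_mono le_rfl ((ht _ _).trans
      (OrderHomClass.mono t (inf_le_inf_right b (hu a))))).trans hsn

theorem symmetric_iff (h : IsConicFrame up down) :
    (inducedRel up down).Symmetric ↔ up = down := by
  constructor
  · intro hR
    -- By symmetry the transpose of `O` is saturated too, so `O` also absorbs transposed reductions.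
    have swap : ∀ O ∈ inducedRel up down, ∀ a b, rect (up a ⊓ b) (a ⊓ down b) ≤ O →
        rect b a ≤ O := by
      intro O hO a b hab
      rw [hR] at hO
      obtain ⟨n, hn, hOn⟩ := LocRel.mem_op.1 hO
      rw [hOn] at hab ⊢
      exact h.mem_inducedRel.1 hn a b hab
    refine funext fun x => le_antisymm ?_ ?_
    -- The transposed reduction of `⊤ ⊗ x` has second side `down x`, hence lies in `O`; then `x ⊗ ⊤`
    -- does too, which says `up x ≤ down x`.
    · obtain ⟨O, hO, hOF⟩ := h.exists_up_inf_le ⊤ (down x)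
      have := swap O hO ⊤ x ((hOF _ _).2 (inf_le_right.trans inf_le_right))
      simpa only [hOF, top_inf_eq, inf_top_eq] using this
    · obtain ⟨O, hO, hOF⟩ := h.exists_inf_down_le ⊤ (up x)
      have := swap O hO x ⊤ ((hOF _ _).2 (inf_le_left.trans inf_le_left))
      simpa only [hOF, top_inf_eq, inf_top_eq] using this
  · rintro rfl
    -- With equal cones, reduction commutes with transposition.
    have swap : ∀ O n : Coprod L L, (∀ a b, rect a b ≤ O ↔ rect b a ≤ n) →
        n ∈ inducedRel up up → O ∈ inducedRel up up := by
      intro O n hOn hn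
      refine h.mem_inducedRel.2 fun a b hab => ?_
      rw [hOn] at hab ⊢
      refine h.mem_inducedRel.1 hn b a ?_
      rwa [inf_comm b, inf_comm _ a]
    refine Sublocale.ext fun O => ⟨fun hO => ?_, fun hO => ?_⟩
    · obtain ⟨n, hn⟩ := exists_coprod (fun a b => rect b a ≤ O)
        (fun A b => by simp only [rect_sSup_right, iSup_le_iff])
        (fun a B => by simp only [rect_sSup_left, iSup_le_iff])
      exact LocRel.mem_op.2 ⟨n, swap n O hn hO, fun a b => (hn b a).symm⟩
    · obtain ⟨n, hn, hOn⟩ := LocRel.mem_op.1 hO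
      exact swap O n hOn hn

end IsConicFrame

end Cones

end ConicFrames

theorem mainTheorem6 {L : Type*} [Order.Frame L] (up down : L → L)
    (h : ConicFrames.IsConicFrame up down) :
    (ConicFrames.LocRel.Reflexive (ConicFrames.inducedRel up down) ↔
      ConicFrames.Inflationary up ∧ ConicFrames.Inflationary down) ∧
    (ConicFrames.LocRel.Transitive (ConicFrames.inducedRel up down) ↔
      ConicFrames.Subidempotent up ∧ ConicFrames.Subidempotent down) ∧
    (ConicFrames.LocRel.Symmetric (ConicFrames.inducedRel up down) ↔ up = down) :=
  ⟨h.reflexive_iff, h.transitive_iff, h.symmetric_iff⟩
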